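/- **Model.** Consider a slotted $K\times N$ switch and a finite traffic pattern, i.e. a finite set of flows $(i,J)$, where $i$ is an input and $J\neq\emptyset$ is the fanout set of outputs. In each slot every output receives a packet from at most one input, and every input sends a single packet, of one flow, which it may send to any set of outputs in the fanout of that flow. The packet sent for a flow is a linear combination, over a finite field $\mathbb F$, of packets of the same flow that arrived in earlier slots. The schedule and the code may depend on all earlier arrivals (and on an independent random seed). The virtual queue of a subflow $(i,J,j)$, $j\in J$, is the dimension of the space spanned by the coefficient vectors known at input $i$ minus that of the space spanned by the coefficient vectors received by output $j$, for the flow $(i,J)$. It is strongly stable if $\limsup_n \frac1n\sum_{t<n}\mathbb E[q_{iJj}(t)]<\infty$. Arrivals $a_{iJ}(t)\in\mathbb N$ are *admissible of rate* $\mathbf r\in\mathbb R_+^f$ ($f$ is the number of flows) if, with $H(t)$ the history of all arrivals before slot $t$: $\frac1n\sum_{t<n}\mathbb E[a_{iJ}(t)]\to r_{iJ}$; $\mathbb E[a_{iJ}(t)^2\mid H(t)]\le A_{\max}^2$ for all $t$ and some constant $A_{\max}$; and for every $\delta>0$ there is $T\ge1$ with $\mathbb E[\frac1T\sum_{k<T}a_{iJ}(t_0+k)\mid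 H(t_0)]\le r_{iJ}+\delta$ for all $t_0$. The enhanced conflict graph $G$ has the subflows as vertices; distinct $(i,J,j)$ and $(i',J',j')$ are adjacent iff $j=j'$, or $i=i'$ and $J\ne J'$. $STAB(G)$ is the convex hull of the incidence vectors of the stable sets of $G$, and $\mathbf e(\mathbf r)_{iJj}=r_{iJ}$. The rate region $\mathbf R$ is the set of all $\mathbf r\in\mathbb R_+^f$ for which there is a schedule and linear intra-flow coding scheme over $\mathbb F$ that keeps all virtual queues strongly stable for every admissible arrival process of rate $\mathbf r$. **Claim.** 1. If, for some admissible arrival process of rate $\mathbf r$, some schedule and coding scheme over $\mathbb F$ keeps all virtual queues strongly stable, then $\mathbf r\in\mathbb R_+^f$ and $\mathbf e(\mathbf r)\in STAB(G)$. 2. If $|\mathbb F|\ge |J|$ for every flow $(i,J)$, then (a) $\overline{\mathbf R}=\{\mathbf r\in\mathbb R_+^f:\ \mathbf e(\mathbf r)\in STAB(G)\}$; (b) $\mathbf r\in\mathbf R$ whenever $\mathbf r\in\mathbb R_+^f$ and $\mathbf e((1+\varepsilon)\mathbf r)\in STAB(G)$ for some $\varepsilon>0$; (c) the set of all $\mathbf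 r$ for which some admissible arrival process of rate $\mathbf r$ can be served by some schedule and coding scheme over $\mathbb F$ with all virtual queues strongly stable is exactly $\{\mathbf r\in\mathbb R_+^f:\ \mathbf e(\mathbf r)\in STAB(G)\}$. -/

import Mathlib

open MeasureTheory Filter Topology
open scoped ENNReal

noncomputable section

/-- A (finite) traffic pattern in a `K × N` switch: a collection of flows `(i, J)`, each given by an
input `i` and a nonempty fanout set `J` of outputs. -/
structure TrafficPattern (K N : ℕ) where
  flows : Finset (Fin K × Finset (Fin N))
  fanout_nonempty : ∀ f ∈ flows, f.2.Nonempty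

namespace TrafficPattern

variable {K N : ℕ}

/-- The flows of the pattern. -/
abbrev Flow (P : TrafficPattern K N) : Type := {f : Fin K × Finset (Fin N) // f ∈ P.flows}

/-- The input of a flow. -/
def Flow.input {P : TrafficPattern K N} (f : P.Flow) : Fin K := f.1.1

/-- The fanout set of a flow. -/
def Flow.fanout {P : TrafficPattern K N} (f : P.Flow) : Finset (Fin N) := f.1.2

/-- The subflows `(i, J, j)` of the pattern: a flow `(i, J)` and an output `j ∈ J`. -/
abbrev Subflow (P : TrafficPattern K N) : Type := {v : P.Flow × Fin N // v.2 ∈ v.1.fanout}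

/-- The flow to which a subflow belongs. -/
def Subflow.flow {P : TrafficPattern K N} (v : P.Subflow) : P.Flow := v.1.1

/-- The output of a subflow. -/
def Subflow.output {P : TrafficPattern K N} (v : P.Subflow) : Fin N := v.1.2

/-- The enhanced conflict graph: two distinct subflows are adjacent iff they have the same output,
or they have the same input and different fanout sets. -/
def enhancedConflictGraph (P : TrafficPattern K N) : SimpleGraph P.Subflow where
  Adj u v := u ≠ v ∧ (u.output = v.output ∨
    (u.flow.input = v.flow.input ∧ u.flow.fanout ≠ v.flow.fanout))
  symm := ⟨fun _ _ h => ⟨h.1.symm, h.2.imp Eq.symm fun h' => ⟨h'.1.symm, h'.2.symm⟩⟩⟩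
  loopless := ⟨fun _ h => h.1 rfl⟩

/-- The enhanced rate vector: every subflow gets the rate of its flow. -/
def enhancedRate (P : TrafficPattern K N) (r : P.Flow → ℝ) : P.Subflow → ℝ := fun v => r v.flow

end TrafficPattern

/-- The stable set polytope of a graph: the convex hull of the incidence vectors of its stable
sets. -/
def stableSetPolytope {V : Type*} (G : SimpleGraph V) : Set (V → ℝ) :=
  convexHull ℝ {x | ∃ S : Set V, G.IsIndepSet S ∧ x = S.indicator fun _ => (1 : ℝ)}

namespace TrafficPattern

variable {K N : ℕ}

/-- A switch configuration for one slot. `recv j` is the flow (if any) from which output `j` receives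
a packet in the slot. An output receives from at most one input because `recv` is a function; an
input can send one packet only, so the outputs connected to the same input all receive (the same
packet) from the same flow. -/
structure Configuration (P : TrafficPattern K N) where
  recv : Fin N → Option P.Flow
  mem_fanout : ∀ j f, recv j = some f → j ∈ f.fanout
  one_packet_per_input : ∀ j j' f f', recv j = some f → recv j' = some f' →
    f.input = f'.input → f = f'

/-- An arrival path: `a t f` is the number of packets of flow `f` that arrive in slot `t`. -/
abbrev ArrivalPath (P : TrafficPattern K N) : Type := ℕ → P.Flow → ℕ

/-- The number of packets of flow `f` that arrive before slot `t`. -/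
def arrivedBefore {P : TrafficPattern K N} (a : P.ArrivalPath) (t : ℕ) (f : P.Flow) : ℕ :=
  ∑ τ ∈ Finset.range t, a τ f

/-- The knowledge space of the input of flow `f` at the beginning of slot `t`. The packets of a flow
are numbered `0, 1, 2, …` by order of arrival, and a linear combination of them over `𝔽` is
represented by its coefficient vector `ℕ →₀ 𝔽`. -/
def inputKnowledge {P : TrafficPattern K N} (𝔽 : Type) [Field 𝔽] (a : P.ArrivalPath) (t : ℕ)
    (f : P.Flow) : Submodule 𝔽 (ℕ →₀ 𝔽) :=
  Submodule.span 𝔽 {c | ∃ k < arrivedBefore a t f, c = Finsupp.single k 1}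

/-- A schedule together with a linear intra-flow coding scheme over `𝔽`. In slot `t`, knowing the
arrivals in the slots before `t` (and, if wanted, a random seed drawn from `[0,1]`), it chooses a
switch configuration and, for every flow, the coefficient vector of the coded packet which is sent to
all outputs that are connected to that flow in this slot. A coded packet is a linear combination of
packets of its own flow that have already arrived. -/
structure Scheme (P : TrafficPattern K N) (𝔽 : Type) [Field 𝔽] where
  config : ℕ → unitInterval → P.ArrivalPath → P.Configuration
  code : ℕ → unitInterval → P.ArrivalPath → P.Flow → (ℕ →₀ 𝔽)
  code_mem : ∀ t s a f, code t s a f ∈ inputKnowledge 𝔽 a t f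
  config_causal : ∀ t s a b, (∀ τ < t, a τ = b τ) → config t s a = config t s b
  code_causal : ∀ t s a b, (∀ τ < t, a τ = b τ) → code t s a = code t s b
  config_measurable : ∀ t a C, MeasurableSet {s | config t s a = C}
  code_measurable : ∀ t a f c, MeasurableSet {s | code t s a f = c}

namespace Scheme

variable {P : TrafficPattern K N} {𝔽 : Type} [Field 𝔽]

/-- The knowledge space of output `j` with respect to flow `f` at the beginning of slot `t`: the span
of the coefficient vectors of all coded packets of `f` that `j` has received before. -/
def outputKnowledge (S : Scheme P 𝔽) (s : unitInterval) (a : P.ArrivalPath) (t : ℕ)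
    (f : P.Flow) (j : Fin N) : Submodule 𝔽 (ℕ →₀ 𝔽) :=
  Submodule.span 𝔽 {c | ∃ τ < t, (S.config τ s a).recv j = some f ∧ c = S.code τ s a f}

/-- An output never knows more than the input, so that the subtraction in `virtualQueue` does not
truncate. -/
theorem outputKnowledge_le (S : Scheme P 𝔽) (s : unitInterval) (a : P.ArrivalPath) (t : ℕ)
    (f : P.Flow) (j : Fin N) : S.outputKnowledge s a t f j ≤ inputKnowledge 𝔽 a t f := by
  refine Submodule.span_le.2 ?_
  rintro c ⟨τ, hτ, -, rfl⟩
  refine Submodule.span_mono ?_ (S.code_mem τ s a f)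
  rintro c ⟨k, hk, rfl⟩
  exact ⟨k, hk.trans_le (Finset.sum_le_sum_of_subset (Finset.range_subset_range.2 hτ.le)), rfl⟩

/-- The size of the virtual queue of a subflow at the beginning of slot `t`: the difference between
the dimensions of the knowledge spaces of its input and of its output with respect to its flow. -/
def virtualQueue (S : Scheme P 𝔽) (s : unitInterval) (a : P.ArrivalPath) (t : ℕ)
    (v : P.Subflow) : ℕ :=
  Module.finrank 𝔽 (inputKnowledge 𝔽 a t v.flow) -
    Module.finrank 𝔽 (S.outputKnowledge s a t v.flow v.output)

/-- Under arrivals with law `μ` (and an independent uniform seed), every virtual queue is strongly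
stable: its time average expected backlog is finite. -/
def KeepsStronglyStable (S : Scheme P 𝔽) (μ : Measure P.ArrivalPath) : Prop :=
  ∀ v : P.Subflow,
    limsup (fun n : ℕ => (∑ t ∈ Finset.range n,
      ∫⁻ x : P.ArrivalPath × unitInterval, (S.virtualQueue x.2 x.1 t v : ℝ≥0∞)
        ∂(μ.prod volume)) / (n : ℝ≥0∞)) atTop < ⊤

end Scheme

/-- The history at the beginning of slot `t`: the σ-algebra generated by the arrivals of all flows in
the slots before `t`. -/
abbrev history (P : TrafficPattern K N) (t : ℕ) : MeasurableSpace P.ArrivalPath :=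
  MeasurableSpace.comap (fun (a : P.ArrivalPath) (τ : Fin t) => a τ) inferInstance

/-- `μ` is the law of an admissible arrival process with rate vector `r`. -/
structure IsArrivalLaw (P : TrafficPattern K N) (r : P.Flow → ℝ) (μ : Measure P.ArrivalPath) :
    Prop where
  isProbabilityMeasure : IsProbabilityMeasure μ
  integrable_sq : ∀ t f, Integrable (fun a : P.ArrivalPath => (a t f : ℝ) ^ 2) μ
  tendsto_rate : ∀ f, Tendsto
    (fun n : ℕ => (∑ t ∈ Finset.range n, ∫ a : P.ArrivalPath, (a t f : ℝ) ∂μ) / n) atTop (𝓝 (r f))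
  second_moment : ∃ A : ℝ, ∀ t f,
    ∀ᵐ x ∂μ, (μ[fun a : P.ArrivalPath => (a t f : ℝ) ^ 2 | P.history t]) x ≤ A ^ 2
  uniform_rate : ∀ f, ∀ δ > 0, ∃ T : ℕ, 0 < T ∧ ∀ t₀,
    ∀ᵐ x ∂μ, (μ[fun a : P.ArrivalPath => (∑ k ∈ Finset.range T, (a (t₀ + k) f : ℝ)) / T |
      P.history t₀]) x ≤ r f + δ

/-- The rate region for linear intra-flow coding over `𝔽`: the nonnegative rate vectors `r` for which
there is one schedule and coding scheme that keeps all virtual queues strongly stable for every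
admissible arrival process of rate `r`. -/
def rateRegion (P : TrafficPattern K N) (𝔽 : Type) [Field 𝔽] : Set (P.Flow → ℝ) :=
  {r | 0 ≤ r ∧ ∃ S : Scheme P 𝔽, ∀ μ, P.IsArrivalLaw r μ → S.KeepsStronglyStable μ}

/-- The rate vectors for which some admissible arrival process of that rate can be served with all
virtual queues strongly stable. -/
def weakRateRegion (P : TrafficPattern K N) (𝔽 : Type) [Field 𝔽] : Set (P.Flow → ℝ) :=
  {r | ∃ μ, P.IsArrivalLaw r μ ∧ ∃ S : Scheme P 𝔽, S.KeepsStronglyStable μ}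

/-- The nonnegative rate vectors whose enhanced rate vector is in the stable set polytope of the
enhanced conflict graph. -/
def stableRates (P : TrafficPattern K N) : Set (P.Flow → ℝ) :=
  {r | 0 ≤ r ∧ P.enhancedRate r ∈ stableSetPolytope P.enhancedConflictGraph}

end TrafficPattern

end

/-!
The switch is described by the stable sets of the enhanced conflict graph: the subflows served in one
slot form a stable set, and every stable set is served by some configuration
(`Configuration.isIndepSet_served`, `exists_configuration_served_eq`).

*Necessity.* An output learns at most one dimension per slot in which it is served, so that the
expected number of arrivals of a flow exceeds the expected service of each of its subflows by at most
the expected virtual queue (`Scheme.expected_arrivals_le`). Strong stability bounds the expected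
virtual queues along a sequence of slots. The time average of the expected service is an average of
incidence vectors of stable sets, and the stable set polytope is closed and closed under decreasing
coordinates, so the rates lie in it in the limit (`mem_stableRates_of_keepsStronglyStable`).

*Coding.* A vector space over a field with `q` elements is not a union of `q` proper subspaces. So an
input can always send a packet that is innovative for every output of the fanout set that does not
know everything yet. Under a fixed sequence of configurations with such packets, each virtual queue is
dominated by a single-server queue (`virtualQueue_fixedScheme_le`).

*Scheduling.* As the scheme may depend on the rates, no queue-dependent schedule is needed: a point of
the stable set polytope is realized by a fixed sequence of configurations, with a bounded error on
every interval of slots (`exists_schedule`, by a greedy choice). If `(1 + ε) r` is in the region, then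
mixing in a little of every flow gives service rates that exceed all `r f` by some `γ > 0`. The
quadratic drift over a long block of slots then shows that each queue is strongly stable
(`IsArrivalLaw.exists_sum_lintegral_backlog_le`). On the boundary, the rounded fluid arrivals
`⌊r (t + 1)⌋ - ⌊r t⌋` exceed the offered service by at most a bounded amount on every interval, which
bounds the queues (`mem_weakRateRegion`).
-/

/-! ### The stable set polytope -/

section StableSetPolytope

variable {V : Type*} {G : SimpleGraph V}

theorem indicator_mem_stableSetPolytope {S : Set V} (hS : G.IsIndepSet S) :
    S.indicator (fun _ => (1 : ℝ)) ∈ stableSetPolytope G :=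
  subset_convexHull ℝ _ ⟨S, hS, rfl⟩

theorem convex_stableSetPolytope : Convex ℝ (stableSetPolytope G) :=
  convex_convexHull ℝ _

theorem isClosed_stableSetPolytope [Finite V] : IsClosed (stableSetPolytope G) := by
  have hfin : {x : V → ℝ | ∃ S : Set V, G.IsIndepSet S ∧ x = S.indicator fun _ => (1 : ℝ)}.Finite :=
    (Set.finite_range fun S : Set V => S.indicator fun _ => (1 : ℝ)).subset
      (by rintro x ⟨S, -, rfl⟩; exact ⟨S, rfl⟩)
  exact hfin.isClosed_convexHull ℝ

/-- Deleting a vertex from every stable set of a convex combination replaces the coordinate of that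
vertex by `0`. -/
theorem update_zero_mem_stableSetPolytope [DecidableEq V] {x : V → ℝ}
    (hx : x ∈ stableSetPolytope G) (v : V) :
    Function.update x v 0 ∈ stableSetPolytope G := by
  obtain ⟨ι, _, w, z, hw0, hw1, hz, rfl⟩ := mem_convexHull_iff_exists_fintype.1 hx
  have key : Function.update (∑ i, w i • z i) v 0 = ∑ i, w i • Function.update (z i) v 0 := by
    funext u
    by_cases h : u = v
    · subst h; simp [Finset.sum_apply]
    · simp [Finset.sum_apply, h]
  rw [key]
  refine convex_stableSetPolytope.sum_mem (fun i _ => hw0 i) hw1 fun i _ => ?_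
  obtain ⟨S, hS, hzS⟩ := hz i
  have : Function.update (z i) v 0 = (S \ {v}).indicator fun _ => (1 : ℝ) := by
    rw [hzS]
    funext u
    by_cases h : u = v
    · subst h; simp
    · by_cases huS : u ∈ S <;> simp [h, huS]
  rw [this]
  exact indicator_mem_stableSetPolytope (hS.mono Set.sdiff_subset)

theorem update_mem_stableSetPolytope [DecidableEq V] {x : V → ℝ}
    (hx : x ∈ stableSetPolytope G) (v : V) {c : ℝ} (hc0 : 0 ≤ c) (hcx : c ≤ x v) :
    Function.update x v c ∈ stableSetPolytope G := by
  rcases hc0.eq_or_lt with rfl | hc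
  · exact update_zero_mem_stableSetPolytope hx v
  have hxv : 0 < x v := hc.trans_le hcx
  have key : Function.update x v c = (c / x v) • x + (1 - c / x v) • Function.update x v 0 := by
    funext u
    by_cases h : u = v
    · subst h; simp [hxv.ne']
    · simp [h]; ring
  rw [key]
  exact convex_stableSetPolytope hx (update_zero_mem_stableSetPolytope hx v) (by positivity)
    (sub_nonneg.2 ((div_le_one hxv).2 hcx)) (by ring)

/-- The stable set polytope is closed under decreasing coordinates, as long as they stay
nonnegative. -/
theorem mem_stableSetPolytope_of_le [Finite V] {x y : V → ℝ}
    (hx : x ∈ stableSetPolytope G) (hy0 : 0 ≤ y) (hyx : y ≤ x) : y ∈ stableSetPolytope G := by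
  classical
  have := Fintype.ofFinite V
  have key : ∀ s : Finset V, (fun v => if v ∈ s then y v else x v) ∈ stableSetPolytope G := by
    intro s
    induction s using Finset.induction_on with
    | empty => simpa using hx
    | insert a s ha ih =>
      have h := update_mem_stableSetPolytope ih a (hy0 a) (by simpa [ha] using hyx a)
      convert h using 1
      funext u
      by_cases hu : u = a
      · subst hu; simp
      · simp [hu]
  simpa using key Finset.univ

end StableSetPolytope

namespace TrafficPattern

variable {K N : ℕ} {P : TrafficPattern K N}

/-! ### Configurations and stable sets -/

/-- The subflows that are served by a configuration. -/
def Configuration.served (C : P.Configuration) : Set P.Subflow :=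
  {v | C.recv v.output = some v.flow}

theorem Configuration.isIndepSet_served (C : P.Configuration) :
    P.enhancedConflictGraph.IsIndepSet C.served := by
  intro u hu v hv huv hadj
  change C.recv u.output = some u.flow at hu
  change C.recv v.output = some v.flow at hv
  rcases hadj.2 with h | ⟨h, h'⟩
  · rw [h, hv] at hu
    exact huv (Subtype.ext (Prod.ext (Option.some.inj hu).symm h))
  · exact h' (congrArg Flow.fanout (C.one_packet_per_input _ _ _ _ hu hv h))

theorem exists_configuration_served_eq {S : Set P.Subflow}
    (hS : P.enhancedConflictGraph.IsIndepSet S) : ∃ C : P.Configuration, C.served = S := by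
  classical
  let recv : Fin N → Option P.Flow := fun j =>
    if h : ∃ v ∈ S, Subflow.output v = j then some h.choose.flow else none
  have hrecv : ∀ j f, recv j = some f → ∃ v ∈ S, v.output = j ∧ v.flow = f := by
    intro j f h
    by_cases hj : ∃ v ∈ S, Subflow.output v = j
    · simp only [recv, dif_pos hj, Option.some.injEq] at h
      exact ⟨hj.choose, hj.choose_spec.1, hj.choose_spec.2, h⟩
    · simp only [recv, dif_neg hj, reduceCtorEq] at h
  have huniq : ∀ u ∈ S, ∀ v ∈ S, u.output = v.output → u = v := by
    intro u hu v hv h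
    by_contra hne
    exact hS hu hv hne ⟨hne, Or.inl h⟩
  refine ⟨⟨recv, ?_, ?_⟩, ?_⟩
  · intro j f h
    obtain ⟨v, -, rfl, rfl⟩ := hrecv j f h
    exact v.2
  · intro j j' f f' h h' hin
    obtain ⟨u, hu, -, rfl⟩ := hrecv j f h
    obtain ⟨v, hv, -, rfl⟩ := hrecv j' f' h'
    by_contra hne
    have huv : u ≠ v := fun h => hne (congrArg _ h)
    exact hS hu hv huv ⟨huv, Or.inr ⟨hin, fun hJ => hne (Subtype.ext (Prod.ext hin hJ))⟩⟩
  · ext v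
    constructor
    · intro h
      obtain ⟨u, hu, hj, hf⟩ := hrecv _ _ h
      exact (Subtype.ext (Prod.ext hf hj) : u = v) ▸ hu
    · intro hv
      have hj : ∃ u ∈ S, Subflow.output u = v.output := ⟨v, hv, rfl⟩
      have := huniq _ hj.choose_spec.1 _ hv hj.choose_spec.2
      change recv v.output = some v.flow
      simp only [recv, dif_pos hj, this]

instance : Finite P.Configuration :=
  Finite.of_injective Configuration.recv fun C D h => by cases C; cases D; cases h; rfl

/-- Serving all outputs of a single flow at once is a stable set. -/
theorem isIndepSet_flow (f : P.Flow) :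
    P.enhancedConflictGraph.IsIndepSet {v : P.Subflow | v.flow = f} := by
  intro u hu v hv huv hadj
  simp only [Set.mem_ofPred_eq] at hu hv
  rcases hadj.2 with h | ⟨-, h⟩
  · exact huv (Subtype.ext (Prod.ext (hu.trans hv.symm) h))
  · exact h (by rw [hu, hv])

end TrafficPattern

/-! ### Schedules of bounded discrepancy -/

/-- The state of the greedy schedule for the target frequencies `w`: the number of slots given to
each index so far. In each slot the index with the largest value of `w i * (t + 1)` minus its count
is served. -/
noncomputable def greedyCount {ι : Type*} [Fintype ι] [Nonempty ι] [DecidableEq ι] (w : ι → ℝ) :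
    ℕ → ι → ℕ
  | 0 => 0
  | t + 1 => greedyCount w t +
      Pi.single (Finite.exists_max fun i => w i * (t + 1) - greedyCount w t i).choose 1

/-- Every probability vector is the frequency vector of a sequence, up to a bounded error on each
initial segment. -/
theorem exists_seq_count_sub_le {ι : Type*} [Fintype ι] [DecidableEq ι] {w : ι → ℝ}
    (hw0 : ∀ i, 0 ≤ w i) (hw1 : ∑ i, w i = 1) :
    ∃ σ : ℕ → ι, ∀ t i,
      |w i * t - ∑ τ ∈ Finset.range t, (if σ τ = i then (1 : ℝ) else 0)| ≤ Fintype.card ι := by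
  have : Nonempty ι := by
    by_contra h
    rw [not_nonempty_iff] at h
    simp at hw1
  let σ : ℕ → ι := fun t => (Finite.exists_max fun i => w i * (t + 1) - greedyCount w t i).choose
  have hσ : ∀ t i, w i * (t + 1) - greedyCount w t i ≤ w (σ t) * (t + 1) - greedyCount w t (σ t) :=
    fun t => (Finite.exists_max fun i => w i * (t + 1) - greedyCount w t i).choose_spec
  have hcount : ∀ t i, (greedyCount w t i : ℝ) =
      ∑ τ ∈ Finset.range t, (if σ τ = i then (1 : ℝ) else 0) := by
    intro t i
    induction t with
    | zero => simp [greedyCount]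
    | succ t ih =>
      rw [Finset.sum_range_succ, ← ih]
      change ((greedyCount w t i + Pi.single (M := fun _ => ℕ) (σ t) 1 i : ℕ) : ℝ) = _
      by_cases h : σ t = i
      · subst h; simp
      · simp [h, Ne.symm h]
  have hsum : ∀ t, ∑ i, (w i * t - greedyCount w t i) = 0 := by
    intro t
    simp only [hcount, Finset.sum_sub_distrib, ← Finset.sum_mul, hw1]
    rw [Finset.sum_comm]
    simp
  -- The values `w i * (t + 1) - greedyCount w t i` add up to `1`, so the largest one is positive
  -- before the greedy step decreases it by `1`.
  have hlow : ∀ t i, -1 ≤ w i * t - greedyCount w t i := by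
    intro t
    induction t with
    | zero => intro i; simp [greedyCount]
    | succ t ih =>
      intro i
      have hpos : 0 ≤ w (σ t) * (t + 1) - greedyCount w t (σ t) := by
        by_contra hneg
        have h1 : ∑ i, (w i * (t + 1) - greedyCount w t i) < 0 :=
          Finset.sum_neg (fun i _ => (hσ t i).trans_lt (not_le.1 hneg)) Finset.univ_nonempty
        have h2 : ∑ i, (w i * (t + 1) - greedyCount w t i) = 1 := by
          have := hsum t
          simp only [Finset.sum_sub_distrib, mul_add, mul_one, Finset.sum_add_distrib, hw1] at this ⊢
          linarith
        linarith
      have hstep : (greedyCount w (t + 1) i : ℝ) = greedyCount w t i + if σ t = i then 1 else 0 := by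
        rw [hcount, hcount, Finset.sum_range_succ]
      rw [hstep]
      push_cast
      by_cases h : σ t = i
      · subst h; simp; linarith
      · have := ih i
        have := hw0 i
        simp [h]; linarith
  refine ⟨σ, fun t i => ?_⟩
  rw [← hcount]
  have hcard : (1 : ℝ) ≤ Fintype.card ι := by exact_mod_cast Fintype.card_pos
  refine abs_le.2 ⟨by linarith [hlow t i], ?_⟩
  have h1 := hsum t
  rw [← Finset.add_sum_erase _ _ (Finset.mem_univ i)] at h1
  have h2 : ∑ _k ∈ Finset.univ.erase i, (-1 : ℝ) ≤
      ∑ k ∈ Finset.univ.erase i, (w k * t - greedyCount w t k) :=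
    Finset.sum_le_sum fun k _ => hlow t k
  have h3 : ((Finset.univ.erase i).card : ℝ) ≤ Fintype.card ι := by
    exact_mod_cast Finset.card_le_univ _
  simp only [Finset.sum_const, nsmul_eq_mul] at h2
  linarith

namespace TrafficPattern

variable {K N : ℕ} {P : TrafficPattern K N}

/-- Whether a configuration serves a subflow, as a number. -/
noncomputable def Configuration.service (C : P.Configuration) (v : P.Subflow) : ℕ :=
  open Classical in if v ∈ C.served then 1 else 0

theorem Configuration.service_le_one (C : P.Configuration) (v : P.Subflow) : C.service v ≤ 1 := by
  unfold Configuration.service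
  split_ifs <;> simp

theorem Configuration.cast_service (C : P.Configuration) (v : P.Subflow) :
    (C.service v : ℝ) = C.served.indicator (fun _ => (1 : ℝ)) v := by
  unfold Configuration.service
  by_cases h : v ∈ C.served <;> simp [h]

/-- A point of the stable set polytope is realized by a fixed sequence of configurations, with a
bounded error on every interval of slots. -/
theorem exists_schedule {x : P.Subflow → ℝ} (hx : x ∈ stableSetPolytope P.enhancedConflictGraph) :
    ∃ (C : ℕ → P.Configuration) (B : ℝ), ∀ (v : P.Subflow) (u t : ℕ), u ≤ t →
      x v * ((t : ℝ) - u) - B ≤ ∑ τ ∈ Finset.Ico u t, ((C τ).service v : ℝ) := by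
  classical
  obtain ⟨ι, _, w, z, hw0, hw1, hz, rfl⟩ := mem_convexHull_iff_exists_fintype.1 hx
  choose S hS hzS using hz
  choose D hD using fun i => exists_configuration_served_eq (hS i)
  obtain ⟨σ, hσ⟩ := exists_seq_count_sub_le hw0 hw1
  refine ⟨fun t => D (σ t), ∑ _i : ι, 2 * (Fintype.card ι : ℝ), fun v u t hut => ?_⟩
  have hserv : ∀ τ, ((D (σ τ)).service v : ℝ) = ∑ i, (if σ τ = i then (1 : ℝ) else 0) * z i v := by
    intro τ
    simp [Configuration.cast_service, hD, hzS]
  simp only [hserv]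
  rw [Finset.sum_comm]
  simp only [Finset.sum_apply, Pi.smul_apply, smul_eq_mul, Finset.sum_mul]
  rw [← Finset.sum_sub_distrib]
  refine Finset.sum_le_sum fun i _ => ?_
  have h1 := abs_le.1 (hσ t i)
  have h2 := abs_le.1 (hσ u i)
  have h3 := Finset.sum_Ico_eq_sub (fun τ => if σ τ = i then (1 : ℝ) else 0) hut
  have hz0 : z i v = 0 ∨ z i v = 1 := by
    rw [hzS]; by_cases h : v ∈ S i <;> simp [h]
  rw [← Finset.sum_mul]
  rcases hz0 with h | h
  · simp [h]
  · rw [h, h3]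
    linarith

end TrafficPattern

/-! ### Innovative packets -/

/-- A vector space over a field with `q` elements is not the union of `q` proper subspaces. -/
theorem Submodule.exists_mem_forall_notMem_of_card_le {ι F M : Type*} [Field F] [Fintype F]
    [AddCommGroup M] [Module F M] (V : Submodule F M) (p : ι → Submodule F M) (s : Finset ι)
    (hs : s.card ≤ Fintype.card F) (hp : ∀ i ∈ s, ¬ V ≤ p i) :
    ∃ c ∈ V, ∀ i ∈ s, c ∉ p i := by
  classical
  induction s using Finset.induction_on with
  | empty => exact ⟨0, V.zero_mem, by simp⟩
  | insert j s hj ih =>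
    rw [Finset.card_insert_of_notMem hj] at hs
    obtain ⟨x, hxV, hx⟩ := ih (by lia) fun i hi => hp i (Finset.mem_insert_of_mem hi)
    by_cases hxj : x ∈ p j
    · obtain ⟨y, hyV, hy⟩ := SetLike.not_le_iff_exists.1 (hp j (Finset.mem_insert_self j s))
      -- The line `y + F x` avoids `p j` and meets every other subspace in at most one point.
      by_cases hline : ∃ l : F, ∀ i ∈ s, y + l • x ∉ p i
      · obtain ⟨l, hl⟩ := hline
        refine ⟨y + l • x, V.add_mem hyV (V.smul_mem l hxV), fun i hi => ?_⟩
        rcases Finset.mem_insert.1 hi with rfl | hi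
        · exact fun h => hy ((Submodule.add_mem_iff_left _ (Submodule.smul_mem _ l hxj)).1 h)
        · exact hl i hi
      · push Not at hline
        choose g hgs hg using hline
        obtain ⟨l, -, m, -, hne, hlm⟩ := Finset.exists_ne_map_eq_of_card_lt_of_maps_to
          (s := Finset.univ) (t := s) (f := g) (by rw [Finset.card_univ]; lia)
          (fun l _ => hgs l)
        have h := Submodule.sub_mem _ (hg l) (hlm ▸ hg m)
        rw [add_sub_add_left_eq_sub, ← sub_smul] at h
        exact absurd ((Submodule.smul_mem_iff _ (sub_ne_zero.2 hne)).1 h) (hx _ (hgs l))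
    · refine ⟨x, hxV, fun i hi => ?_⟩
      rcases Finset.mem_insert.1 hi with rfl | hi
      exacts [hxj, hx i hi]

/-- A vector of `V` outside of each of the subspaces `U j`, `j ∈ s`, that do not contain `V`;
`0` if there is none. -/
noncomputable def innovativeVector {ι F M : Type*} [Field F] [AddCommGroup M] [Module F M]
    (V : Submodule F M) (U : ι → Submodule F M) (s : Finset ι) : M :=
  open Classical in
  if h : ∃ c ∈ V, ∀ j ∈ s, ¬ V ≤ U j → c ∉ U j then h.choose else 0

theorem innovativeVector_mem {ι F M : Type*} [Field F] [AddCommGroup M] [Module F M]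
    (V : Submodule F M) (U : ι → Submodule F M) (s : Finset ι) : innovativeVector V U s ∈ V := by
  unfold innovativeVector
  split_ifs with h
  exacts [h.choose_spec.1, V.zero_mem]

theorem innovativeVector_notMem {ι F M : Type*} [Field F] [Fintype F] [AddCommGroup M]
    [Module F M] {V : Submodule F M} {U : ι → Submodule F M} {s : Finset ι}
    (hs : s.card ≤ Fintype.card F) {j : ι} (hj : j ∈ s) (hV : ¬ V ≤ U j) :
    innovativeVector V U s ∉ U j := by
  classical
  have h : ∃ c ∈ V, ∀ j ∈ s, ¬ V ≤ U j → c ∉ U j := by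
    obtain ⟨c, hcV, hc⟩ := V.exists_mem_forall_notMem_of_card_le U (s.filter fun j => ¬ V ≤ U j)
      ((Finset.card_filter_le _ _).trans hs) fun i hi => (Finset.mem_filter.1 hi).2
    exact ⟨c, hcV, fun i hi hVi => hc i (Finset.mem_filter.2 ⟨hi, hVi⟩)⟩
  unfold innovativeVector
  rw [dif_pos h]
  exact h.choose_spec.2 j hj hV

namespace TrafficPattern

variable {K N : ℕ} {P : TrafficPattern K N}

theorem arrivedBefore_succ (a : P.ArrivalPath) (t : ℕ) (f : P.Flow) :
    arrivedBefore a (t + 1) f = arrivedBefore a t f + a t f :=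
  Finset.sum_range_succ _ _

theorem arrivedBefore_congr {a b : P.ArrivalPath} {t : ℕ} (h : ∀ τ < t, a τ = b τ) (f : P.Flow) :
    arrivedBefore a t f = arrivedBefore b t f :=
  Finset.sum_congr rfl fun τ hτ => by rw [h τ (Finset.mem_range.1 hτ)]

section Knowledge

variable (𝔽 : Type) [Field 𝔽]

theorem inputKnowledge_eq_span_range (a : P.ArrivalPath) (t : ℕ) (f : P.Flow) :
    inputKnowledge 𝔽 a t f = Submodule.span 𝔽
      (Set.range fun k : Fin (arrivedBefore a t f) => Finsupp.single (k : ℕ) (1 : 𝔽)) := by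
  unfold inputKnowledge
  congr 1
  ext c
  exact ⟨fun ⟨k, hk, h⟩ => ⟨⟨k, hk⟩, h.symm⟩, fun ⟨k, h⟩ => ⟨k, k.2, h.symm⟩⟩

theorem finrank_inputKnowledge (a : P.ArrivalPath) (t : ℕ) (f : P.Flow) :
    Module.finrank 𝔽 (inputKnowledge 𝔽 a t f) = arrivedBefore a t f := by
  have h : LinearIndependent 𝔽 fun k : ℕ => Finsupp.single k (1 : 𝔽) := by
    simpa using (Finsupp.basisSingleOne (R := 𝔽) (ι := ℕ)).linearIndependent
  rw [inputKnowledge_eq_span_range]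
  exact (finrank_span_eq_card (h.comp _ Fin.val_injective)).trans (Fintype.card_fin _)

instance (a : P.ArrivalPath) (t : ℕ) (f : P.Flow) :
    FiniteDimensional 𝔽 (inputKnowledge 𝔽 a t f) := by
  rw [inputKnowledge_eq_span_range]
  exact FiniteDimensional.span_of_finite 𝔽 (Set.finite_range _)

variable {𝔽}

instance (S : Scheme P 𝔽) (s : unitInterval) (a : P.ArrivalPath) (t : ℕ) (f : P.Flow)
    (j : Fin N) : FiniteDimensional 𝔽 (S.outputKnowledge s a t f j) :=
  Submodule.finiteDimensional_of_le (S.outputKnowledge_le s a t f j)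

/-- An output learns at most one dimension in each slot in which it is served. -/
theorem finrank_outputKnowledge_le (S : Scheme P 𝔽) (s : unitInterval) (a : P.ArrivalPath) (t : ℕ)
    (v : P.Subflow) : Module.finrank 𝔽 (S.outputKnowledge s a t v.flow v.output) ≤
      ∑ τ ∈ Finset.range t, (S.config τ s a).service v := by
  classical
  let F : Finset (ℕ →₀ 𝔽) := ((Finset.range t).filter fun τ => v ∈ (S.config τ s a).served).image
    fun τ => S.code τ s a v.flow
  have h : S.outputKnowledge s a t v.flow v.output = Submodule.span 𝔽 (F : Set (ℕ →₀ 𝔽)) := by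
    unfold Scheme.outputKnowledge
    congr 1
    ext c
    simp only [F, Finset.coe_image, Finset.coe_filter, Finset.mem_range, Set.mem_image,
      Set.mem_ofPred_eq]
    exact ⟨fun ⟨τ, h1, h2, h3⟩ => ⟨τ, ⟨h1, h2⟩, h3.symm⟩,
      fun ⟨τ, ⟨h1, h2⟩, h3⟩ => ⟨τ, h1, h2, h3.symm⟩⟩
  rw [h]
  refine (finrank_span_finset_le_card F).trans (Finset.card_image_le.trans ?_)
  rw [Finset.card_filter]
  exact Finset.sum_le_sum fun τ _ => by unfold Configuration.service; split_ifs <;> simp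

/-- The coded packets of the flow `f` under the fixed schedule `C`: in every slot, a combination that
is innovative for all outputs of the fanout set that do not know everything yet. -/
noncomputable def innovativeCode (𝔽 : Type) [Field 𝔽] (C : ℕ → P.Configuration)
    (a : P.ArrivalPath) (f : P.Flow) (t : ℕ) : ℕ →₀ 𝔽 :=
  innovativeVector (inputKnowledge 𝔽 a t f)
    (fun j => Submodule.span 𝔽 {c | ∃ τ : Fin t, (C τ).recv j = some f ∧
      c = innovativeCode 𝔽 C a f τ}) f.fanout
termination_by t
decreasing_by exact τ.2

theorem innovativeCode_congr (C : ℕ → P.Configuration) (f : P.Flow) (t : ℕ) :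
    ∀ a b : P.ArrivalPath, (∀ τ < t, a τ = b τ) →
      innovativeCode 𝔽 C a f t = innovativeCode 𝔽 C b f t := by
  induction t using Nat.strong_induction_on with
  | h t ih =>
    intro a b hab
    have h : ∀ τ : Fin t, innovativeCode 𝔽 C a f τ = innovativeCode 𝔽 C b f τ :=
      fun τ => ih τ τ.2 a b fun σ hσ => hab σ (hσ.trans τ.2)
    rw [innovativeCode, innovativeCode]
    simp only [h, inputKnowledge, arrivedBefore_congr hab]

/-- The scheme that follows a fixed sequence of configurations and sends innovative packets. It does
not use the random seed. -/
noncomputable def fixedScheme (𝔽 : Type) [Field 𝔽] (C : ℕ → P.Configuration) : Scheme P 𝔽 where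
  config t _ _ := C t
  code t _ a f := innovativeCode 𝔽 C a f t
  code_mem t _ a f := by
    rw [innovativeCode]
    exact innovativeVector_mem _ _ _
  config_causal _ _ _ _ _ := rfl
  code_causal t _ a b h := funext fun f => innovativeCode_congr C f t a b h
  config_measurable _ _ _ := MeasurableSet.const _
  code_measurable _ _ _ _ := MeasurableSet.const _

end Knowledge

end TrafficPattern

/-! ### Comparison with a single-server queue -/

/-- The backlog of a slotted single-server queue with `s t` units of service offered and `a t`
arrivals in slot `t`; arrivals can be served from the next slot on. The subtraction truncates, as
unused service is lost. -/
def backlog (s a : ℕ → ℕ) : ℕ → ℕ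
  | 0 => 0
  | t + 1 => (backlog s a t - s t) + a t

namespace TrafficPattern

variable {K N : ℕ} {P : TrafficPattern K N}

/-- If the field is large enough, then every service opportunity of a subflow with a nonempty virtual
queue reduces that queue. -/
theorem virtualQueue_fixedScheme_le {𝔽 : Type} [Field 𝔽] [Fintype 𝔽]
    (hF : ∀ f : P.Flow, f.fanout.card ≤ Fintype.card 𝔽) (C : ℕ → P.Configuration)
    (s : unitInterval) (a : P.ArrivalPath) (t : ℕ) (v : P.Subflow) :
    (fixedScheme 𝔽 C).virtualQueue s a t v ≤
      backlog (fun τ => (C τ).service v) (fun τ => a τ v.flow) t := by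
  induction t with
  | zero => simp [Scheme.virtualQueue, finrank_inputKnowledge, arrivedBefore]
  | succ t ih =>
    unfold Scheme.virtualQueue at ih ⊢
    rw [finrank_inputKnowledge] at ih ⊢
    rw [arrivedBefore_succ, backlog]
    set U := (fixedScheme 𝔽 C).outputKnowledge s a t v.flow v.output with hU
    set U' := (fixedScheme 𝔽 C).outputKnowledge s a (t + 1) v.flow v.output with hU'
    have hUU' : U ≤ U' := by
      refine Submodule.span_mono ?_
      rintro c ⟨τ, hτ, h⟩
      exact ⟨τ, hτ.trans t.lt_succ_self, h⟩
    have hmono : Module.finrank 𝔽 U ≤ Module.finrank 𝔽 U' := Submodule.finrank_mono hUU'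
    by_cases hv : v ∈ (C t).served
    · have hs : (C t).service v = 1 := by simp [Configuration.service, hv]
      by_cases hle : inputKnowledge 𝔽 a t v.flow ≤ U
      · have := Submodule.finrank_mono hle
        rw [finrank_inputKnowledge] at this
        lia
      · have hUspan : U = Submodule.span 𝔽 {c | ∃ τ : Fin t, (C τ).recv v.output = some v.flow ∧
            c = innovativeCode 𝔽 C a v.flow τ} := by
          rw [hU]
          unfold Scheme.outputKnowledge
          congr 1
          ext c
          exact ⟨fun ⟨τ, h1, h2, h3⟩ => ⟨⟨τ, h1⟩, h2, h3⟩, fun ⟨τ, h2, h3⟩ => ⟨τ, τ.2, h2, h3⟩⟩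
        have hnot : innovativeCode 𝔽 C a v.flow t ∉ U := by
          rw [innovativeCode, hUspan]
          rw [hUspan] at hle
          exact innovativeVector_notMem (U := fun j => Submodule.span 𝔽
            {c | ∃ τ : Fin t, (C τ).recv j = some v.flow ∧ c = innovativeCode 𝔽 C a v.flow τ})
            (hF v.flow) v.2 hle
        have hmem : innovativeCode 𝔽 C a v.flow t ∈ U' :=
          Submodule.subset_span ⟨t, t.lt_succ_self, hv, rfl⟩
        have hlt : U < U' := lt_of_le_of_ne hUU' fun h => hnot (h ▸ hmem)
        have := Submodule.finrank_lt_finrank_of_lt hlt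
        lia
    · have hs : (C t).service v = 0 := by simp [Configuration.service, hv]
      lia

theorem measurable_backlog {m : MeasurableSpace P.ArrivalPath} (s : ℕ → ℕ) (f : P.Flow) (t : ℕ)
    (h : ∀ τ < t, Measurable[m] fun a : P.ArrivalPath => a τ f) :
    Measurable[m] fun a : P.ArrivalPath => backlog s (fun τ => a τ f) t := by
  induction t with
  | zero => exact measurable_const
  | succ t ih =>
    exact ((measurable_from_nat (f := fun n => n - s t)).comp
      (ih fun τ hτ => h τ (hτ.trans t.lt_succ_self))).add (h t t.lt_succ_self)

/-- Strong stability of all virtual queues follows from the strong stability of the single-server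
queues which see the arrivals of the flows and the service offered by the schedule. -/
theorem keepsStronglyStable_fixedScheme {𝔽 : Type} [Field 𝔽] [Fintype 𝔽]
    (hF : ∀ f : P.Flow, f.fanout.card ≤ Fintype.card 𝔽) (C : ℕ → P.Configuration)
    {μ : Measure P.ArrivalPath} [SFinite μ] {M : P.Subflow → ℝ}
    (h : ∀ v, ∀ᶠ n : ℕ in atTop, ∑ t ∈ Finset.range n, ∫⁻ a : P.ArrivalPath,
      (backlog (fun τ => (C τ).service v) (fun τ => a τ v.flow) t : ℝ≥0∞) ∂μ ≤
        ENNReal.ofReal (M v * n)) :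
    (fixedScheme 𝔽 C).KeepsStronglyStable μ := by
  intro v
  refine lt_of_le_of_lt (b := ENNReal.ofReal (M v)) ?_ ENNReal.ofReal_lt_top
  refine limsup_le_of_le (by isBoundedDefault) ?_
  filter_upwards [h v, eventually_gt_atTop 0] with n hn hn0
  have hn0' : (0 : ℝ) < n := Nat.cast_pos.2 hn0
  refine ENNReal.div_le_of_le_mul ?_
  rw [← ENNReal.ofReal_natCast n, ← ENNReal.ofReal_mul' hn0'.le]
  refine le_trans (Finset.sum_le_sum fun t _ => ?_) hn
  calc ∫⁻ x : P.ArrivalPath × unitInterval,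
        ((fixedScheme 𝔽 C).virtualQueue x.2 x.1 t v : ℝ≥0∞) ∂(μ.prod volume)
      ≤ ∫⁻ x : P.ArrivalPath × unitInterval,
        (backlog (fun τ => (C τ).service v) (fun τ => x.1 τ v.flow) t : ℝ≥0∞) ∂(μ.prod volume) :=
        lintegral_mono fun x => Nat.cast_le.2 (virtualQueue_fixedScheme_le hF C x.2 x.1 t v)
    _ = ∫⁻ a : P.ArrivalPath,
        (backlog (fun τ => (C τ).service v) (fun τ => a τ v.flow) t : ℝ≥0∞) ∂μ :=
        measurePreserving_fst.lintegral_comp (f := fun a : P.ArrivalPath =>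
          (backlog (fun τ => (C τ).service v) (fun τ => a τ v.flow) t : ℝ≥0∞))
          (measurable_from_nat.comp (measurable_backlog _ _ t fun τ _ => by fun_prop))

end TrafficPattern

/-! ### Quadratic drift of a single-server queue -/

theorem backlog_add_le (s a : ℕ → ℕ) (t T : ℕ) :
    backlog s a (t + T) ≤ (backlog s a t - ∑ k ∈ Finset.range T, s (t + k)) +
      ∑ k ∈ Finset.range T, a (t + k) := by
  induction T with
  | zero => simp
  | succ T ih =>
    rw [← add_assoc, backlog, Finset.sum_range_succ, Finset.sum_range_succ]
    lia

theorem backlog_le_sum (s a : ℕ → ℕ) (t : ℕ) : backlog s a t ≤ ∑ τ ∈ Finset.range t, a τ := by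
  simpa [backlog] using backlog_add_le s a 0 t

theorem backlog_add_sq_le (s a : ℕ → ℕ) (t T : ℕ) :
    (backlog s a (t + T) : ℝ) ^ 2 ≤ (backlog s a t : ℝ) ^ 2 +
      (∑ k ∈ Finset.range T, (s (t + k) : ℝ)) ^ 2 + (∑ k ∈ Finset.range T, (a (t + k) : ℝ)) ^ 2 +
      2 * (backlog s a t * ∑ k ∈ Finset.range T, (a (t + k) : ℝ)) -
      2 * (∑ k ∈ Finset.range T, (s (t + k) : ℝ)) * backlog s a t := by
  have h := backlog_add_le s a t T
  have hS : ((∑ k ∈ Finset.range T, s (t + k) : ℕ) : ℝ) = ∑ k ∈ Finset.range T, (s (t + k) : ℝ) :=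
    by push_cast; rfl
  have hA : ((∑ k ∈ Finset.range T, a (t + k) : ℕ) : ℝ) = ∑ k ∈ Finset.range T, (a (t + k) : ℝ) :=
    by push_cast; rfl
  rw [← hS, ← hA]
  generalize (∑ k ∈ Finset.range T, s (t + k)) = S at *
  generalize (∑ k ∈ Finset.range T, a (t + k)) = A at *
  generalize backlog s a (t + T) = q' at *
  generalize backlog s a t = q at *
  have hq : (0 : ℝ) ≤ q := q.cast_nonneg
  have hA0 : (0 : ℝ) ≤ A := A.cast_nonneg
  have hS0 : (0 : ℝ) ≤ S := S.cast_nonneg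
  rcases le_total S q with hSq | hqS
  · have h' : (q' : ℝ) ≤ q - S + A := by
      have : q' + S ≤ q + A := by lia
      have : (q' : ℝ) + S ≤ q + A := by exact_mod_cast this
      linarith
    calc (q' : ℝ) ^ 2 ≤ (q - S + A) ^ 2 := by gcongr
      _ ≤ _ := by nlinarith
  · have h' : (q' : ℝ) ≤ A := by exact_mod_cast (by lia : q' ≤ A)
    calc (q' : ℝ) ^ 2 ≤ A ^ 2 := by gcongr
      _ ≤ _ := by nlinarith [sq_nonneg ((q : ℝ) - S), mul_nonneg hq hA0]

namespace TrafficPattern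

variable {K N : ℕ} {P : TrafficPattern K N}

theorem measurable_history {u τ : ℕ} (h : τ < u) (f : P.Flow) :
    Measurable[P.history u] fun a : P.ArrivalPath => a τ f := by
  have h1 : Measurable fun b : Fin u → P.Flow → ℕ => b ⟨τ, h⟩ f := by fun_prop
  exact h1.comp (comap_measurable fun (a : P.ArrivalPath) (τ : Fin u) => a τ)

theorem history_le (t : ℕ) : P.history t ≤ (inferInstance : MeasurableSpace P.ArrivalPath) :=
  Measurable.comap_le (by fun_prop)

namespace IsArrivalLaw

variable {r : P.Flow → ℝ} {μ : Measure P.ArrivalPath}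

theorem memLp_two (hμ : P.IsArrivalLaw r μ) (t : ℕ) (f : P.Flow) :
    MemLp (fun a : P.ArrivalPath => (a t f : ℝ)) 2 μ :=
  (memLp_two_iff_integrable_sq (Measurable.aestronglyMeasurable (by fun_prop))).2
    (hμ.integrable_sq t f)

theorem memLp_two_sum (hμ : P.IsArrivalLaw r μ) (t T : ℕ) (f : P.Flow) :
    MemLp (fun a : P.ArrivalPath => ∑ k ∈ Finset.range T, (a (t + k) f : ℝ)) 2 μ :=
  memLp_finsetSum _ fun _ _ => hμ.memLp_two _ f

theorem memLp_two_backlog (hμ : P.IsArrivalLaw r μ) (s : ℕ → ℕ) (t : ℕ) (f : P.Flow) :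
    MemLp (fun a : P.ArrivalPath => (backlog s (fun τ => a τ f) t : ℝ)) 2 μ := by
  refine (hμ.memLp_two_sum 0 t f).mono (Measurable.aestronglyMeasurable
    (measurable_from_nat.comp (measurable_backlog s f t fun τ _ => by fun_prop))) ?_
  refine ae_of_all _ fun a => ?_
  have h : (backlog s (fun τ => a τ f) t : ℝ) ≤ ∑ k ∈ Finset.range t, (a (0 + k) f : ℝ) := by
    simpa using (Nat.cast_le (α := ℝ)).2 (backlog_le_sum s (fun τ => a τ f) t)
  rw [Real.norm_of_nonneg (Nat.cast_nonneg _)]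
  exact h.trans (le_abs_self _)

theorem exists_integral_sq_le (hμ : P.IsArrivalLaw r μ) :
    ∃ A : ℝ, ∀ t f, ∫ a : P.ArrivalPath, (a t f : ℝ) ^ 2 ∂μ ≤ A ^ 2 := by
  have := hμ.isProbabilityMeasure
  obtain ⟨A, hA⟩ := hμ.second_moment
  refine ⟨A, fun t f => ?_⟩
  rw [← integral_condExp (history_le t)]
  refine (integral_mono_ae integrable_condExp (integrable_const (A ^ 2)) (hA t f)).trans ?_
  simp

theorem integral_sum_sq_le (hμ : P.IsArrivalLaw r μ) {A : ℝ}
    (hA : ∀ t f, ∫ a : P.ArrivalPath, (a t f : ℝ) ^ 2 ∂μ ≤ A ^ 2) (t T : ℕ) (f : P.Flow) :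
    ∫ a : P.ArrivalPath, (∑ k ∈ Finset.range T, (a (t + k) f : ℝ)) ^ 2 ∂μ ≤ T ^ 2 * A ^ 2 := by
  have hint : Integrable (fun a : P.ArrivalPath =>
      ∑ k ∈ Finset.range T, (a (t + k) f : ℝ) ^ 2) μ :=
    integrable_finsetSum _ fun k _ => hμ.integrable_sq (t + k) f
  calc ∫ a : P.ArrivalPath, (∑ k ∈ Finset.range T, (a (t + k) f : ℝ)) ^ 2 ∂μ
      ≤ ∫ a : P.ArrivalPath, T * ∑ k ∈ Finset.range T, (a (t + k) f : ℝ) ^ 2 ∂μ := by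
        refine integral_mono (hμ.memLp_two_sum t T f).integrable_sq (hint.const_mul _) fun a => ?_
        simpa using sq_sum_le_card_mul_sum_sq (s := Finset.range T)
          (f := fun k => (a (t + k) f : ℝ))
    _ = T * ∑ k ∈ Finset.range T, ∫ a : P.ArrivalPath, (a (t + k) f : ℝ) ^ 2 ∂μ := by
        rw [integral_const_mul, integral_finsetSum _ fun k _ => hμ.integrable_sq (t + k) f]
    _ ≤ T * ∑ _k ∈ Finset.range T, A ^ 2 := by
        gcongr with k _
        exact hA _ f
    _ = T ^ 2 * A ^ 2 := by simp; ring

/-- The bound on the conditional arrival rate of a block of `T` slots, tested against a random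
variable that is known at the beginning of the block. -/
theorem integral_mul_sum_le (hμ : P.IsArrivalLaw r μ) {f : P.Flow} {T u : ℕ} {c : ℝ} (hT : 0 < T)
    (hc : ∀ᵐ x ∂μ, (μ[fun a : P.ArrivalPath => (∑ k ∈ Finset.range T, (a (u + k) f : ℝ)) / T |
      P.history u]) x ≤ c) {X : P.ArrivalPath → ℝ} (hX0 : 0 ≤ X)
    (hXm : StronglyMeasurable[P.history u] X) (hX : MemLp X 2 μ) :
    ∫ a, X a * ∑ k ∈ Finset.range T, (a (u + k) f : ℝ) ∂μ ≤ T * c * ∫ a, X a ∂μ := by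
  have := hμ.isProbabilityMeasure
  have hT' : (0 : ℝ) < T := Nat.cast_pos.2 hT
  set Y : P.ArrivalPath → ℝ := fun a => (∑ k ∈ Finset.range T, (a (u + k) f : ℝ)) / T with hY
  have hY2 : MemLp Y 2 μ := by
    simpa only [hY, div_eq_inv_mul] using (hμ.memLp_two_sum u T f).const_mul (T : ℝ)⁻¹
  have hXY : Integrable (X * Y) μ := hX.integrable_mul hY2
  have hpull := condExp_mul_of_stronglyMeasurable_left hXm hXY (hY2.integrable (by norm_num))
  have h1 : ∫ a, X a * Y a ∂μ ≤ ∫ a, X a * c ∂μ := by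
    rw [show (∫ a, X a * Y a ∂μ) = ∫ a, (X * Y) a ∂μ from rfl, ← integral_condExp (history_le u)]
    refine integral_mono_ae integrable_condExp
      ((hX.integrable (by norm_num)).mul_const c) ?_
    filter_upwards [hpull, hc] with a ha hca
    rw [ha]
    exact mul_le_mul_of_nonneg_left hca (hX0 a)
  have h2 : ∫ a, X a * ∑ k ∈ Finset.range T, (a (u + k) f : ℝ) ∂μ = T * ∫ a, X a * Y a ∂μ := by
    rw [← integral_const_mul]
    refine integral_congr_ae (ae_of_all _ fun a => ?_)
    simp only [hY]
    field_simp
  rw [h2, mul_assoc]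
  rw [integral_mul_const] at h1
  exact mul_le_mul_of_nonneg_left (h1.trans_eq (mul_comm _ _)) hT'.le

/-- The bound of `integral_mul_sum_le` for `m` consecutive blocks. -/
theorem integral_mul_sum_blocks_le (hμ : P.IsArrivalLaw r μ) {f : P.Flow} {T t : ℕ} {c : ℝ}
    (hT : 0 < T) (hc : ∀ u, ∀ᵐ x ∂μ, (μ[fun a : P.ArrivalPath =>
      (∑ k ∈ Finset.range T, (a (u + k) f : ℝ)) / T | P.history u]) x ≤ c)
    {X : P.ArrivalPath → ℝ} (hX0 : 0 ≤ X)
    (hXm : ∀ u, t ≤ u → StronglyMeasurable[P.history u] X) (hX : MemLp X 2 μ) (m : ℕ) :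
    ∫ a, X a * ∑ k ∈ Finset.range (m * T), (a (t + k) f : ℝ) ∂μ ≤
      (m * T : ℕ) * c * ∫ a, X a ∂μ := by
  induction m with
  | zero => simp
  | succ m ih =>
    have hsplit : ∀ a : P.ArrivalPath, X a * ∑ k ∈ Finset.range ((m + 1) * T), (a (t + k) f : ℝ) =
        X a * ∑ k ∈ Finset.range (m * T), (a (t + k) f : ℝ) +
        X a * ∑ k ∈ Finset.range T, (a (t + m * T + k) f : ℝ) := by
      intro a
      rw [add_mul, one_mul, Finset.sum_range_add, mul_add]
      simp only [add_assoc]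
    simp only [hsplit]
    have hint : ∀ u L : ℕ, Integrable (fun a : P.ArrivalPath =>
        X a * ∑ k ∈ Finset.range L, (a (u + k) f : ℝ)) μ :=
      fun u L => hX.integrable_mul (hμ.memLp_two_sum u L f)
    rw [integral_add (hint _ _) (hint _ _)]
    have h := hμ.integral_mul_sum_le hT (hc (t + m * T)) hX0 (hXm _ (Nat.le_add_right _ _)) hX
    push_cast at ih ⊢
    linarith

/-- A queue that is offered more service than its arrival rate, up to a bounded error on every
interval, is strongly stable. -/
theorem exists_sum_lintegral_backlog_le (hμ : P.IsArrivalLaw r μ) {f : P.Flow} {s : ℕ → ℕ}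
    (hs1 : ∀ t, s t ≤ 1) {γ B : ℝ} (hγ : 0 < γ)
    (hs : ∀ u t : ℕ, u ≤ t → (r f + γ) * ((t : ℝ) - u) - B ≤ ∑ τ ∈ Finset.Ico u t, (s τ : ℝ)) :
    ∃ M : ℝ, ∀ᶠ n : ℕ in atTop, ∑ t ∈ Finset.range n, ∫⁻ a : P.ArrivalPath,
      (backlog s (fun τ => a τ f) t : ℝ≥0∞) ∂μ ≤ ENNReal.ofReal (M * n) := by
  have := hμ.isProbabilityMeasure
  obtain ⟨A, hA⟩ := hμ.exists_integral_sq_le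
  obtain ⟨T₁, hT₁, hrate⟩ := hμ.uniform_rate f (γ / 2) (by positivity)
  have hT₁' : (1 : ℝ) ≤ T₁ := by exact_mod_cast hT₁
  -- Over `T` slots the expected surplus of service outweighs the error `B`.
  obtain ⟨m, hm⟩ := exists_nat_ge (max 0 (B + 1) / (γ / 2))
  rw [div_le_iff₀ (by positivity)] at hm
  set T : ℕ := m * T₁ with hT
  have hTB : B + 1 ≤ T * (γ / 2) := by
    have h0 : (0 : ℝ) ≤ m * (γ / 2) := by positivity
    calc B + 1 ≤ m * (γ / 2) := (le_max_right _ _).trans hm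
      _ ≤ m * (γ / 2) * T₁ := le_mul_of_one_le_right h0 hT₁'
      _ = T * (γ / 2) := by rw [hT]; push_cast; ring
  set Q : ℕ → P.ArrivalPath → ℝ := fun t a => (backlog s (fun τ => a τ f) t : ℝ) with hQ
  have hQ0 : ∀ t, 0 ≤ Q t := fun t a => Nat.cast_nonneg _
  have hQ2 : ∀ t, MemLp (Q t) 2 μ := fun t => hμ.memLp_two_backlog s t f
  have hQint : ∀ t, Integrable (Q t) μ := fun t => (hQ2 t).integrable (by norm_num)
  have hdrift : ∀ t, ∫ a, Q (t + T) a ^ 2 ∂μ ≤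
      ∫ a, Q t a ^ 2 ∂μ + ((T : ℝ) ^ 2 + T ^ 2 * A ^ 2) - 2 * ∫ a, Q t a ∂μ := by
    intro t
    set S : ℝ := ∑ k ∈ Finset.range T, (s (t + k) : ℝ) with hS
    have hS0 : 0 ≤ S := Finset.sum_nonneg fun _ _ => Nat.cast_nonneg _
    have hST : S ≤ T := by
      calc S ≤ ∑ _k ∈ Finset.range T, (1 : ℝ) :=
            Finset.sum_le_sum fun k _ => by exact_mod_cast hs1 (t + k)
        _ = T := by simp
    have hSlow : (r f + γ / 2) * T + 1 ≤ S := by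
      have h := hs t (t + T) (Nat.le_add_right _ _)
      rw [Finset.sum_Ico_eq_sum_range, Nat.add_sub_cancel_left] at h
      push_cast at h
      nlinarith
    have hcross := hμ.integral_mul_sum_blocks_le (t := t) hT₁ hrate (hQ0 t)
      (fun u hu => (Measurable.stronglyMeasurable (measurable_from_nat.comp
        (measurable_backlog s f t fun τ hτ => measurable_history (hτ.trans_le hu) f)))) (hQ2 t) m
    rw [← hT] at hcross
    have hsq := hμ.integral_sum_sq_le hA t T f
    have hA2 := (hμ.memLp_two_sum t T f).integrable_sq
    have hQA : Integrable (fun a : P.ArrivalPath =>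
        Q t a * ∑ k ∈ Finset.range T, (a (t + k) f : ℝ)) μ :=
      (hQ2 t).integrable_mul (hμ.memLp_two_sum t T f)
    have hI := hQint t
    have hIsq := (hQ2 t).integrable_sq
    have hEQ : 0 ≤ ∫ a, Q t a ∂μ := integral_nonneg (hQ0 t)
    have h1 : Integrable (fun a : P.ArrivalPath => Q t a ^ 2 + S ^ 2) μ :=
      hIsq.add (integrable_const _)
    have h2 : Integrable (fun a : P.ArrivalPath => Q t a ^ 2 + S ^ 2 +
        (∑ k ∈ Finset.range T, (a (t + k) f : ℝ)) ^ 2) μ := h1.add hA2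
    have h3 : Integrable (fun a : P.ArrivalPath => Q t a ^ 2 + S ^ 2 +
        (∑ k ∈ Finset.range T, (a (t + k) f : ℝ)) ^ 2 +
        2 * (Q t a * ∑ k ∈ Finset.range T, (a (t + k) f : ℝ))) μ := h2.add (hQA.const_mul 2)
    have hmono : ∫ a, Q (t + T) a ^ 2 ∂μ ≤ ∫ a, (Q t a ^ 2 + S ^ 2 +
        (∑ k ∈ Finset.range T, (a (t + k) f : ℝ)) ^ 2 +
        2 * (Q t a * ∑ k ∈ Finset.range T, (a (t + k) f : ℝ)) - 2 * S * Q t a) ∂μ := by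
      refine integral_mono (hQ2 _).integrable_sq ?_ fun a => backlog_add_sq_le s (fun τ => a τ f) t T
      exact h3.sub (hI.const_mul _)
    rw [integral_sub h3 (hI.const_mul _), integral_add h2 (hQA.const_mul 2), integral_add h1 hA2,
      integral_add hIsq (integrable_const _), integral_const_mul, integral_const_mul,
      integral_const] at hmono
    simp only [probReal_univ, one_smul] at hmono
    have hS2 : S ^ 2 ≤ (T : ℝ) ^ 2 := by gcongr
    have hlast : ((r f + γ / 2) * T + 1) * ∫ a, Q t a ∂μ ≤ S * ∫ a, Q t a ∂μ := by gcongr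
    linarith
  set D : ℝ := (T : ℝ) ^ 2 + T ^ 2 * A ^ 2 with hD
  set g : ℕ → ℝ := fun t => ∫ a, Q t a ^ 2 ∂μ with hg
  have hg0 : ∀ t, 0 ≤ g t := fun t => integral_nonneg fun a => sq_nonneg _
  have hsum : ∀ n : ℕ, 2 * ∑ t ∈ Finset.range n, ∫ a, Q t a ∂μ ≤
      D * n + ∑ t ∈ Finset.range T, g t := by
    intro n
    have h1 : ∑ t ∈ Finset.range n, (g (t + T) + 2 * ∫ a, Q t a ∂μ) ≤
        ∑ t ∈ Finset.range n, (g t + D) :=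
      Finset.sum_le_sum fun t _ => by have := hdrift t; simp only [hg]; linarith
    have h2 : ∑ t ∈ Finset.range n, g t ≤ ∑ t ∈ Finset.range (T + n), g t :=
      Finset.sum_le_sum_of_subset_of_nonneg (Finset.range_subset_range.2 (Nat.le_add_left _ _))
        fun _ _ _ => hg0 _
    rw [Finset.sum_range_add] at h2
    simp only [Finset.sum_add_distrib, ← Finset.mul_sum, Finset.sum_const, Finset.card_range,
      nsmul_eq_mul] at h1
    simp only [add_comm _ T] at h1
    linarith
  refine ⟨D + ∑ t ∈ Finset.range T, g t, ?_⟩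
  filter_upwards [eventually_ge_atTop 1] with n hn
  have hn' : (1 : ℝ) ≤ n := by exact_mod_cast hn
  have hlint : ∀ t, ∫⁻ a : P.ArrivalPath, (backlog s (fun τ => a τ f) t : ℝ≥0∞) ∂μ =
      ENNReal.ofReal (∫ a, Q t a ∂μ) := by
    intro t
    rw [ofReal_integral_eq_lintegral_ofReal (hQint t) (ae_of_all _ (hQ0 t))]
    simp [hQ]
  simp only [hlint]
  rw [← ENNReal.ofReal_sum_of_nonneg fun t _ => integral_nonneg (hQ0 t)]
  refine ENNReal.ofReal_le_ofReal ?_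
  have hG : 0 ≤ ∑ t ∈ Finset.range T, g t := Finset.sum_nonneg fun t _ => hg0 t
  have hE : 0 ≤ ∑ t ∈ Finset.range n, ∫ a, Q t a ∂μ :=
    Finset.sum_nonneg fun t _ => integral_nonneg (hQ0 t)
  nlinarith [hsum n]

end IsArrivalLaw

/-! ### Rates strictly inside of the region -/

/-- Mixing `(1 + ε) r` with the uniform average of all multicast configurations of single flows
leaves room above every rate, also where `r` vanishes. -/
theorem exists_enhancedRate_add_mem {r : P.Flow → ℝ} {ε : ℝ} (hε : 0 < ε)
    (h : (1 + ε) • r ∈ P.stableRates) :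
    ∃ γ > 0, (fun v : P.Subflow => r v.flow + γ) ∈ stableSetPolytope P.enhancedConflictGraph := by
  classical
  set c : ℝ := (Fintype.card (Option P.Flow) : ℝ) with hc
  have hc0 : 0 < c := Nat.cast_pos.2 Fintype.card_pos
  -- The index `none` stands for the empty stable set, which keeps the average defined when there
  -- is no flow.
  have havg : (fun _ : P.Subflow => c⁻¹) ∈ stableSetPolytope P.enhancedConflictGraph := by
    have h := (convex_stableSetPolytope (G := P.enhancedConflictGraph)).sum_mem
      (t := Finset.univ) (w := fun _ : Option P.Flow => c⁻¹)
      (z := fun o => {v : P.Subflow | some v.flow = o}.indicator fun _ => (1 : ℝ))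
      (fun _ _ => by positivity)
      (by rw [Finset.sum_const, Finset.card_univ, nsmul_eq_mul, ← hc, mul_inv_cancel₀ hc0.ne'])
      (fun o _ => by
        refine indicator_mem_stableSetPolytope (G := P.enhancedConflictGraph) ?_
        cases o with
        | none => simp
        | some f => simpa using isIndepSet_flow f)
    convert h using 1
    funext v
    simp [Finset.sum_apply, Set.indicator]
  refine ⟨ε / (1 + ε) * c⁻¹, by positivity, ?_⟩
  have hmix := convex_stableSetPolytope h.2 havg (a := 1 / (1 + ε)) (b := ε / (1 + ε))
    (by positivity) (by positivity) (by field_simp)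
  convert hmix using 1
  funext v
  simp only [enhancedRate, Pi.add_apply, Pi.smul_apply, smul_eq_mul]
  field_simp

/-- One fixed schedule with service rates above `r` serves all arrival laws of rate `r`. -/
theorem mem_rateRegion_of_mul_mem {𝔽 : Type} [Field 𝔽] [Fintype 𝔽]
    (hF : ∀ f : P.Flow, f.fanout.card ≤ Fintype.card 𝔽) {r : P.Flow → ℝ} {ε : ℝ} (hε : 0 < ε)
    (h : (1 + ε) • r ∈ P.stableRates) : r ∈ P.rateRegion 𝔽 := by
  obtain ⟨γ, hγ, hmem⟩ := exists_enhancedRate_add_mem hε h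
  obtain ⟨C, B, hC⟩ := exists_schedule hmem
  refine ⟨fun f => ?_, fixedScheme 𝔽 C, fun μ hμ => ?_⟩
  · have h0 := h.1 f
    simp only [Pi.zero_apply, Pi.smul_apply, smul_eq_mul] at h0
    exact nonneg_of_mul_nonneg_right h0 (by positivity)
  · have := hμ.isProbabilityMeasure
    choose M hM using fun v : P.Subflow => hμ.exists_sum_lintegral_backlog_le (f := v.flow)
      (fun t => (C t).service_le_one v) hγ (hC v)
    exact keepsStronglyStable_fixedScheme hF C hM

end TrafficPattern

/-! ### Deterministic arrivals of a given rate -/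

/-- The backlog is bounded by the largest surplus of arrivals over service in an interval that ends
now; the summand `1` accounts for the slot of the last unused service. -/
theorem exists_backlog_add_le (s a : ℕ → ℕ) (hs : ∀ t, s t ≤ 1) (t : ℕ) :
    ∃ u ≤ t, backlog s a t + ∑ τ ∈ Finset.Ico u t, s τ ≤ ∑ τ ∈ Finset.Ico u t, a τ + 1 := by
  induction t with
  | zero => exact ⟨0, le_rfl, by simp [backlog]⟩
  | succ t ih =>
    obtain ⟨u, hut, hu⟩ := ih
    have := hs t
    rw [backlog]
    by_cases h : s t ≤ backlog s a t
    · refine ⟨u, hut.trans t.le_succ, ?_⟩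
      rw [Finset.sum_Ico_succ_top hut, Finset.sum_Ico_succ_top hut]
      lia
    · refine ⟨t, t.le_succ, ?_⟩
      rw [Finset.sum_Ico_succ_top le_rfl, Finset.sum_Ico_succ_top le_rfl]
      simp only [Finset.Ico_self, Finset.sum_empty]
      lia

namespace TrafficPattern

variable {K N : ℕ} {P : TrafficPattern K N}

/-- The deterministic arrivals that follow the fluid arrivals `r f * t` up to rounding. -/
noncomputable def fluidPath (r : P.Flow → ℝ) : P.ArrivalPath :=
  fun t f => ⌊r f * (t + 1 : ℕ)⌋₊ - ⌊r f * t⌋₊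

theorem sum_fluidPath {r : P.Flow → ℝ} (hr : 0 ≤ r) (f : P.Flow) (u T : ℕ) :
    ∑ k ∈ Finset.range T, (fluidPath r (u + k) f : ℝ) =
      (⌊r f * (u + T : ℕ)⌋₊ : ℝ) - ⌊r f * u⌋₊ := by
  have h : ∀ k, (fluidPath r (u + k) f : ℝ) =
      (⌊r f * (u + (k + 1) : ℕ)⌋₊ : ℝ) - ⌊r f * (u + k : ℕ)⌋₊ := by
    intro k
    refine Nat.cast_sub (Nat.floor_le_floor (mul_le_mul_of_nonneg_left ?_ (hr f)))
    exact_mod_cast Nat.le_succ _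
  simp only [h]
  exact Finset.sum_range_sub (fun k => (⌊r f * (u + k : ℕ)⌋₊ : ℝ)) T

theorem sum_fluidPath_le {r : P.Flow → ℝ} (hr : 0 ≤ r) (f : P.Flow) (u T : ℕ) :
    ∑ k ∈ Finset.range T, (fluidPath r (u + k) f : ℝ) ≤ r f * T + 1 := by
  rw [sum_fluidPath hr]
  have h1 := Nat.floor_le (mul_nonneg (hr f) (Nat.cast_nonneg (u + T)))
  have h2 := Nat.lt_floor_add_one (r f * u)
  push_cast at *
  linarith

theorem condExp_dirac (t : ℕ) (a : P.ArrivalPath) (g : P.ArrivalPath → ℝ) :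
    (Measure.dirac a)[g | P.history t] =ᵐ[Measure.dirac a] fun _ => g a :=
  (condExp_congr_ae (ae_eq_dirac g)).trans
    (Filter.EventuallyEq.of_eq (condExp_const (history_le t) (g a)))

theorem isArrivalLaw_dirac_fluidPath {r : P.Flow → ℝ} (hr : 0 ≤ r) :
    P.IsArrivalLaw r (Measure.dirac (fluidPath r)) where
  isProbabilityMeasure := inferInstance
  integrable_sq _ _ := integrable_dirac (by simp)
  tendsto_rate f := by
    simp only [integral_dirac]
    have h := (tendsto_nat_floor_mul_div_atTop (hr f)).comp tendsto_natCast_atTop_atTop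
    refine h.congr fun n => ?_
    have := sum_fluidPath hr f 0 n
    simp only [zero_add, Nat.cast_zero, mul_zero, Nat.floor_zero, sub_zero] at this
    simp [this]
  second_moment := by
    refine ⟨∑ f, r f + 1, fun t f => ?_⟩
    filter_upwards [condExp_dirac t (fluidPath r) fun a => (a t f : ℝ) ^ 2] with x hx
    rw [hx]
    have h := sum_fluidPath_le hr f t 1
    simp only [Finset.sum_range_one, add_zero, Nat.cast_one, mul_one] at h
    have h' : r f ≤ ∑ f, r f := Finset.single_le_sum (fun f _ => hr f) (Finset.mem_univ f)
    gcongr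
    linarith
  uniform_rate f δ hδ := by
    obtain ⟨T, hT⟩ := exists_nat_gt (1 / δ)
    have hT0 : (0 : ℝ) < T := lt_trans (by positivity) hT
    refine ⟨T, Nat.cast_pos.1 hT0, fun t₀ => ?_⟩
    filter_upwards [condExp_dirac t₀ (fluidPath r) fun a =>
      (∑ k ∈ Finset.range T, (a (t₀ + k) f : ℝ)) / T] with x hx
    rw [hx, div_le_iff₀ hT0]
    rw [div_lt_iff₀ hδ] at hT
    have h := sum_fluidPath_le hr f t₀ T
    nlinarith

/-- Deterministic arrivals need no surplus of service, so that the boundary of the region is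
included. -/
theorem mem_weakRateRegion {𝔽 : Type} [Field 𝔽] [Fintype 𝔽]
    (hF : ∀ f : P.Flow, f.fanout.card ≤ Fintype.card 𝔽) {r : P.Flow → ℝ}
    (h : r ∈ P.stableRates) : r ∈ P.weakRateRegion 𝔽 := by
  obtain ⟨C, B, hC⟩ := exists_schedule h.2
  refine ⟨_, isArrivalLaw_dirac_fluidPath h.1, fixedScheme 𝔽 C,
    keepsStronglyStable_fixedScheme hF C (M := fun _ => B + 2) fun v => .of_forall fun n => ?_⟩
  have hbound : ∀ t, (backlog (fun τ => (C τ).service v) (fun τ => fluidPath r τ v.flow) t : ℝ) ≤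
      B + 2 := by
    intro t
    obtain ⟨u, hut, hu⟩ := exists_backlog_add_le (fun τ => (C τ).service v)
      (fun τ => fluidPath r τ v.flow) (fun τ => (C τ).service_le_one v) t
    have h1 := hC v u t hut
    have h2 := sum_fluidPath_le h.1 v.flow u (t - u)
    rw [Nat.cast_sub hut] at h2
    rw [Finset.sum_Ico_eq_sum_range (fun τ => fluidPath r τ v.flow)] at hu
    have hu' := (Nat.cast_le (α := ℝ)).2 hu
    push_cast at hu'
    simp only [enhancedRate] at h1
    linarith
  have hB : 0 ≤ B + 2 := (Nat.cast_nonneg _).trans (hbound 0)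
  calc ∑ t ∈ Finset.range n, ∫⁻ a : P.ArrivalPath,
        (backlog (fun τ => (C τ).service v) (fun τ => a τ v.flow) t : ℝ≥0∞)
          ∂(Measure.dirac (fluidPath r))
      ≤ ∑ _t ∈ Finset.range n, ENNReal.ofReal (B + 2) := by
        refine Finset.sum_le_sum fun t _ => ?_
        rw [lintegral_dirac, ← ENNReal.ofReal_natCast]
        exact ENNReal.ofReal_le_ofReal (hbound t)
    _ = ENNReal.ofReal ((B + 2) * n) := by
        rw [Finset.sum_const, Finset.card_range, nsmul_eq_mul, ENNReal.ofReal_mul hB,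
          ENNReal.ofReal_natCast, mul_comm]

end TrafficPattern

/-! ### Necessity -/

/-- Finitely many sequences with bounded averages are infinitely often bounded simultaneously. -/
theorem exists_frequently_le_of_limsup_average_lt_top {ι : Type*} [Fintype ι]
    {g : ι → ℕ → ℝ≥0∞}
    (hg : ∀ i, limsup (fun n : ℕ => (∑ t ∈ Finset.range n, g i t) / (n : ℝ≥0∞)) atTop < ⊤) :
    ∃ M : ℝ, 0 ≤ M ∧ ∃ᶠ n : ℕ in atTop, ∀ i, g i n ≤ ENNReal.ofReal M := by
  choose b hb _ using fun i => ENNReal.lt_iff_exists_nnreal_btwn.1 (hg i)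
  set B : NNReal := ∑ i, b i with hB
  have hev : ∀ᶠ n : ℕ in atTop, ∑ i, ∑ t ∈ Finset.range n, g i t ≤ (B * n : NNReal) := by
    have h := eventually_all.2 fun i => eventually_lt_of_limsup_lt (hb i)
    filter_upwards [h, eventually_gt_atTop 0] with n hn hn0
    have hn0' : (n : ℝ≥0∞) ≠ 0 := by exact_mod_cast hn0.ne'
    rw [hB, Finset.sum_mul, ENNReal.ofNNReal_finsetSum]
    refine Finset.sum_le_sum fun i _ => ?_
    push_cast
    exact (ENNReal.div_le_iff hn0' (ENNReal.natCast_ne_top n)).1 (hn i).le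
  refine ⟨B + 1, by positivity, fun hnot => ?_⟩
  obtain ⟨n₀, hn₀⟩ := eventually_atTop.1 hnot
  obtain ⟨n₁, hn₁⟩ := eventually_atTop.1 hev
  obtain ⟨n₂, hn₂⟩ := exists_nat_gt ((n₀ : ℝ) * (B + 1))
  set n := max n₀ (max n₁ n₂) with hn
  have hn0 : n₀ ≤ n := le_max_left _ _
  have hlarge : ∀ t, n₀ ≤ t → ((B + 1 : NNReal) : ℝ≥0∞) ≤ ∑ i, g i t := by
    intro t ht
    obtain ⟨i, hi⟩ := not_forall.1 (hn₀ t ht)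
    refine le_trans ?_ (Finset.single_le_sum (fun i _ => zero_le) (Finset.mem_univ i))
    refine (le_of_eq ?_).trans (not_le.1 hi).le
    rw [← ENNReal.ofReal_coe_nnreal]
    simp
  have h1 : (((n - n₀ : ℕ) * (B + 1) : NNReal) : ℝ≥0∞) ≤ (B * n : NNReal) := by
    calc (((n - n₀ : ℕ) * (B + 1) : NNReal) : ℝ≥0∞)
        = ∑ _t ∈ Finset.Ico n₀ n, ((B + 1 : NNReal) : ℝ≥0∞) := by
          rw [Finset.sum_const, Nat.card_Ico, nsmul_eq_mul, ENNReal.coe_mul, ENNReal.coe_natCast]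
      _ ≤ ∑ t ∈ Finset.Ico n₀ n, ∑ i, g i t :=
          Finset.sum_le_sum fun t ht => hlarge t (Finset.mem_Ico.1 ht).1
      _ ≤ ∑ t ∈ Finset.range n, ∑ i, g i t :=
          Finset.sum_le_sum_of_subset fun t ht => Finset.mem_range.2 (Finset.mem_Ico.1 ht).2
      _ = ∑ i, ∑ t ∈ Finset.range n, g i t := Finset.sum_comm
      _ ≤ _ := hn₁ n ((le_max_left _ _).trans (le_max_right _ _))
  have h2 : ((n : ℝ) - n₀) * (B + 1) ≤ B * n := by
    rw [← Nat.cast_sub hn0]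
    exact_mod_cast h1
  have h3 : (n₂ : ℝ) ≤ n := by exact_mod_cast (le_max_right _ _).trans (le_max_right _ _)
  linarith

namespace TrafficPattern

variable {K N : ℕ} {P : TrafficPattern K N} {𝔽 : Type} [Field 𝔽]

/-- The configuration of slot `t` depends on the arrivals of finitely many slots only, that is, on a
countable amount of data, and measurably on the seed. -/
theorem Scheme.measurableSet_served (S : Scheme P 𝔽) (t : ℕ) (v : P.Subflow) :
    MeasurableSet {x : P.ArrivalPath × unitInterval | v ∈ (S.config t x.2 x.1).served} := by
  let e : (Fin t → P.Flow → ℕ) → P.ArrivalPath := fun b τ => if h : τ < t then b ⟨τ, h⟩ else 0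
  have he : ∀ a : P.ArrivalPath, ∀ τ < t, a τ = e (fun i => a i) τ := by
    intro a τ hτ
    simp [e, hτ]
  have key : {x : P.ArrivalPath × unitInterval | v ∈ (S.config t x.2 x.1).served} =
      ⋃ b : Fin t → P.Flow → ℕ, {a : P.ArrivalPath | (fun i : Fin t => a i) = b} ×ˢ
        ⋃ C ∈ {C : P.Configuration | v ∈ C.served}, {s | S.config t s (e b) = C} := by
    ext ⟨a, s⟩
    simp only [Set.mem_ofPred_eq, Set.mem_iUnion, Set.mem_prod, exists_prop, exists_eq_left',
      exists_eq_right']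
    rw [S.config_causal t s a _ (he a)]
  rw [key]
  refine MeasurableSet.iUnion fun b => MeasurableSet.prod ?_ ?_
  · have h : Measurable fun (a : P.ArrivalPath) (i : Fin t) => a i := by fun_prop
    exact h (measurableSet_singleton b)
  · exact MeasurableSet.biUnion (Set.to_countable _) fun C _ => S.config_measurable t (e b) C

theorem Scheme.measurable_service (S : Scheme P 𝔽) (t : ℕ) (v : P.Subflow) :
    Measurable fun x : P.ArrivalPath × unitInterval => (S.config t x.2 x.1).service v := by
  classical
  unfold Configuration.service
  exact Measurable.ite (S.measurableSet_served t v) measurable_const measurable_const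

theorem Scheme.integrable_service (S : Scheme P 𝔽)
    (π : Measure (P.ArrivalPath × unitInterval)) [IsFiniteMeasure π] (t : ℕ) (v : P.Subflow) :
    Integrable (fun x => ((S.config t x.2 x.1).service v : ℝ)) π := by
  refine Integrable.of_bound (C := 1)
    (measurable_from_nat.comp (S.measurable_service t v)).aestronglyMeasurable
    (ae_of_all _ fun x => ?_)
  simpa using (S.config t x.2 x.1).service_le_one v

/-- The expected service in a slot is an average of incidence vectors of stable sets. -/
theorem Scheme.integral_service_mem (S : Scheme P 𝔽)
    (π : Measure (P.ArrivalPath × unitInterval)) [IsProbabilityMeasure π] (t : ℕ) :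
    (fun v => ∫ x, ((S.config t x.2 x.1).service v : ℝ) ∂π) ∈
      stableSetPolytope P.enhancedConflictGraph := by
  have hint := S.integrable_service π t
  have h := (convex_stableSetPolytope (G := P.enhancedConflictGraph)).integral_mem
    isClosed_stableSetPolytope (μ := π)
    (f := fun x v => ((S.config t x.2 x.1).service v : ℝ)) (ae_of_all _ fun x => by
      simp only [Configuration.cast_service]
      exact indicator_mem_stableSetPolytope (S.config t x.2 x.1).isIndepSet_served)
    (Integrable.of_eval hint)
  convert h using 1
  funext v
  exact (eval_integral hint v).symm

/-- A subflow whose expected virtual queue at the beginning of slot `n` is at most `M` has been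
served in expectation for all but `M` of its packets. -/
theorem Scheme.expected_arrivals_le (S : Scheme P 𝔽) {r : P.Flow → ℝ}
    {μ : Measure P.ArrivalPath} (hμ : P.IsArrivalLaw r μ) {v : P.Subflow} {n : ℕ} {M : ℝ}
    (hM0 : 0 ≤ M)
    (hM : ∫⁻ x : P.ArrivalPath × unitInterval, (S.virtualQueue x.2 x.1 n v : ℝ≥0∞)
      ∂(μ.prod volume) ≤ ENNReal.ofReal M) :
    ∑ t ∈ Finset.range n, ∫ a : P.ArrivalPath, (a t v.flow : ℝ) ∂μ ≤ M +
      ∑ t ∈ Finset.range n, ∫ x, ((S.config t x.2 x.1).service v : ℝ) ∂(μ.prod volume) := by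
  have := hμ.isProbabilityMeasure
  have hA : ∀ t, Integrable (fun a : P.ArrivalPath => (a t v.flow : ℝ)) μ :=
    fun t => (hμ.memLp_two t v.flow).integrable (by norm_num)
  have hS0 : 0 ≤ ∑ t ∈ Finset.range n,
      ∫ x, ((S.config t x.2 x.1).service v : ℝ) ∂(μ.prod volume) :=
    Finset.sum_nonneg fun t _ => integral_nonneg fun x => Nat.cast_nonneg _
  have hpoint : ∀ x : P.ArrivalPath × unitInterval, arrivedBefore x.1 n v.flow ≤
      S.virtualQueue x.2 x.1 n v + ∑ t ∈ Finset.range n, (S.config t x.2 x.1).service v := by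
    intro x
    have h := finrank_outputKnowledge_le S x.2 x.1 n v
    unfold Scheme.virtualQueue
    rw [finrank_inputKnowledge]
    lia
  have hmeas : Measurable fun x : P.ArrivalPath × unitInterval =>
      ((∑ t ∈ Finset.range n, (S.config t x.2 x.1).service v : ℕ) : ℝ≥0∞) :=
    measurable_from_nat.comp (Finset.measurable_fun_sum _ fun t _ => S.measurable_service t v)
  have hlhs : ENNReal.ofReal (∑ t ∈ Finset.range n, ∫ a : P.ArrivalPath, (a t v.flow : ℝ) ∂μ) =
      ∫⁻ x : P.ArrivalPath × unitInterval, (arrivedBefore x.1 n v.flow : ℝ≥0∞)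
        ∂(μ.prod volume) := by
    rw [← integral_finsetSum _ fun t _ => hA t,
      ofReal_integral_eq_lintegral_ofReal (integrable_finsetSum _ fun t _ => hA t)
        (ae_of_all _ fun a => Finset.sum_nonneg fun t _ => Nat.cast_nonneg _)]
    have h : ∀ a : P.ArrivalPath, ENNReal.ofReal (∑ t ∈ Finset.range n, (a t v.flow : ℝ)) =
        (arrivedBefore a n v.flow : ℝ≥0∞) := by
      intro a
      rw [← ENNReal.ofReal_natCast, arrivedBefore]
      push_cast
      rfl
    simp only [h]
    refine (measurePreserving_fst.lintegral_comp (f := fun a : P.ArrivalPath =>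
      (arrivedBefore a n v.flow : ℝ≥0∞)) (measurable_from_nat.comp ?_)).symm
    exact Finset.measurable_fun_sum _ fun t _ => by fun_prop
  have hrhs : ∫⁻ x : P.ArrivalPath × unitInterval,
      ((∑ t ∈ Finset.range n, (S.config t x.2 x.1).service v : ℕ) : ℝ≥0∞) ∂(μ.prod volume) =
      ENNReal.ofReal (∑ t ∈ Finset.range n,
        ∫ x, ((S.config t x.2 x.1).service v : ℝ) ∂(μ.prod volume)) := by
    have hI := fun t => S.integrable_service (μ.prod volume) t v
    rw [← integral_finsetSum _ fun t _ => hI t,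
      ofReal_integral_eq_lintegral_ofReal (integrable_finsetSum _ fun t _ => hI t)
        (ae_of_all _ fun a => Finset.sum_nonneg fun t _ => Nat.cast_nonneg _)]
    refine lintegral_congr fun x => ?_
    rw [← ENNReal.ofReal_natCast]
    push_cast
    rfl
  rw [← ENNReal.ofReal_le_ofReal_iff (by positivity), ENNReal.ofReal_add hM0 hS0, hlhs, ← hrhs]
  calc ∫⁻ x : P.ArrivalPath × unitInterval, (arrivedBefore x.1 n v.flow : ℝ≥0∞) ∂(μ.prod volume)
      ≤ ∫⁻ x : P.ArrivalPath × unitInterval, ((S.virtualQueue x.2 x.1 n v : ℝ≥0∞) +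
          ((∑ t ∈ Finset.range n, (S.config t x.2 x.1).service v : ℕ) : ℝ≥0∞))
            ∂(μ.prod volume) :=
        lintegral_mono fun x => by
          rw [← Nat.cast_add]
          exact Nat.cast_le.2 (hpoint x)
    _ = _ := lintegral_add_right _ hmeas
    _ ≤ _ := by gcongr

theorem mem_stableRates_of_keepsStronglyStable {r : P.Flow → ℝ} {μ : Measure P.ArrivalPath}
    (hμ : P.IsArrivalLaw r μ) {S : Scheme P 𝔽} (hS : S.KeepsStronglyStable μ) :
    r ∈ P.stableRates := by
  have := hμ.isProbabilityMeasure
  have hr : 0 ≤ r := fun f => ge_of_tendsto' (hμ.tendsto_rate f) fun n =>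
    div_nonneg (Finset.sum_nonneg fun t _ => integral_nonneg fun a => Nat.cast_nonneg _)
      (Nat.cast_nonneg _)
  refine ⟨hr, ?_⟩
  obtain ⟨M, hM0, hM⟩ := exists_frequently_le_of_limsup_average_lt_top hS
  have htend : Tendsto (fun (n : ℕ) (v : P.Subflow) =>
      max 0 ((∑ t ∈ Finset.range n, ∫ a : P.ArrivalPath, (a t v.flow : ℝ) ∂μ) / n - M / n))
      atTop (𝓝 (P.enhancedRate r)) := by
    refine tendsto_pi_nhds.2 fun v => ?_
    have h := (tendsto_const_nhds (x := (0 : ℝ))).max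
      ((hμ.tendsto_rate v.flow).sub (tendsto_const_div_atTop_nhds_zero_nat M))
    rwa [sub_zero, max_eq_right (show 0 ≤ r v.flow from hr v.flow)] at h
  refine isClosed_stableSetPolytope.mem_of_frequently_of_tendsto ?_ htend
  refine (hM.and_eventually (eventually_gt_atTop 0)).mono ?_
  rintro n ⟨hn, hn0⟩
  have hn0' : (0 : ℝ) < n := Nat.cast_pos.2 hn0
  have havg := (convex_stableSetPolytope (G := P.enhancedConflictGraph)).sum_mem
    (t := Finset.range n) (w := fun _ => (n : ℝ)⁻¹) (fun _ _ => by positivity)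
    (by simp [hn0'.ne']) (fun t _ => S.integral_service_mem (μ.prod volume) t)
  refine mem_stableSetPolytope_of_le havg (fun v => le_max_left _ _) fun v => ?_
  simp only [Finset.sum_apply, Pi.smul_apply, smul_eq_mul, ← Finset.mul_sum]
  refine max_le (mul_nonneg (by positivity) (Finset.sum_nonneg fun t _ =>
    integral_nonneg fun x => Nat.cast_nonneg _)) ?_
  have h := S.expected_arrivals_le hμ hM0 (hn v)
  rw [← sub_div, div_eq_inv_mul]
  gcongr
  linarith

/-! ### The rate region -/

theorem isClosed_stableRates : IsClosed P.stableRates := by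
  have h : Continuous (P.enhancedRate : (P.Flow → ℝ) → P.Subflow → ℝ) :=
    continuous_pi fun v => continuous_apply v.flow
  exact (isClosed_le continuous_const continuous_id).inter (isClosed_stableSetPolytope.preimage h)

theorem closure_rateRegion_eq [Fintype 𝔽]
    (hF : ∀ f : P.Flow, f.fanout.card ≤ Fintype.card 𝔽) :
    closure (P.rateRegion 𝔽) = P.stableRates := by
  refine Set.Subset.antisymm (closure_minimal ?_ isClosed_stableRates) fun r hr => ?_
  · rintro r ⟨hr, S, hS⟩
    have hμ := isArrivalLaw_dirac_fluidPath hr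
    exact mem_stableRates_of_keepsStronglyStable hμ (hS _ hμ)
  · have hlim : Tendsto (fun n : ℕ => (1 + 1 / ((n : ℝ) + 1))⁻¹ • r) atTop (𝓝 r) := by
      have h := ((tendsto_const_nhds (x := (1 : ℝ))).add
        (tendsto_one_div_add_atTop_nhds_zero_nat (𝕜 := ℝ))).inv₀ (by norm_num)
      simpa using h.smul_const r
    refine mem_closure_of_tendsto hlim (.of_forall fun n => ?_)
    have hn : (0 : ℝ) < 1 / ((n : ℝ) + 1) := by positivity
    refine mem_rateRegion_of_mul_mem hF hn ?_
    rwa [smul_inv_smul₀ (by positivity)]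

end TrafficPattern

theorem mainTheorem5 {K N : ℕ} (P : TrafficPattern K N) (𝔽 : Type) [Field 𝔽] [Fintype 𝔽] :
    (∀ (r : P.Flow → ℝ) (μ : Measure P.ArrivalPath), P.IsArrivalLaw r μ →
      (∃ S : P.Scheme 𝔽, S.KeepsStronglyStable μ) → r ∈ P.stableRates) ∧
    ((∀ f : P.Flow, f.fanout.card ≤ Fintype.card 𝔽) →
      closure (P.rateRegion 𝔽) = P.stableRates ∧
      (∀ (r : P.Flow → ℝ) (ε : ℝ), 0 < ε → (1 + ε) • r ∈ P.stableRates → r ∈ P.rateRegion 𝔽) ∧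
      P.weakRateRegion 𝔽 = P.stableRates) := by
  refine ⟨fun r μ hμ ⟨S, hS⟩ => TrafficPattern.mem_stableRates_of_keepsStronglyStable hμ hS,
    fun hF => ⟨TrafficPattern.closure_rateRegion_eq hF,
      fun r ε hε h => TrafficPattern.mem_rateRegion_of_mul_mem hF hε h,
      Set.Subset.antisymm ?_ fun r hr => TrafficPattern.mem_weakRateRegion hF hr⟩⟩
  rintro r ⟨μ, hμ, S, hS⟩
  exact TrafficPattern.mem_stableRates_of_keepsStronglyStable hμ hS
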